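/- Let $\mathcal H$ be a complex Hilbert space and let $A\neq 0$ be a positive bounded linear operator on $\mathcal H$. Write $\langle x\mid y\rangle_A=\langle Ax\mid y\rangle$ and $\|x\|_A=\sqrt{\langle x\mid x\rangle_A}$, and for a bounded operator $S$ on $\mathcal H$ put $$\|S\|_A=\sup\{\|Sx\|_A : x\in\mathcal H,\ \|x\|_A=1\},\qquad \omega_A(S)=\sup\{|\langle Sx\mid x\rangle_A| : x\in\mathcal H,\ \|x\|_A=1\}.$$ Let $\mathcal B_A(\mathcal H)$ be the set of bounded operators $S$ on $\mathcal H$ that have an $A$-adjoint, that is, a bounded operator $R$ on $\mathcal H$ with $\langle Sx\mid y\rangle_A=\langle x\mid Ry\rangle_A$ for all $x,y\in\mathcal H$. Let $T\in\mathcal B_A(\mathcal H)$ be such that $\mathcal N(A)^\perp$, the orthogonal complement of the null space of $A$, is invariant under $T$. On the Hilbert space $\mathcal H\oplus\mathcal H$ let $$\mathbb A=\begin{pmatrix}A&0\\0&A\end{pmatrix},\qquad \mathbb T=\begin{pmatrix}I&T\\0&-I\end{pmatrix},$$ and define $\|\mathbb T\|_{\mathbb A}$ and $\omega_{\mathbb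 A}(\mathbb T)$ as above, with $\mathbb A$ and $\mathcal H\oplus\mathcal H$ in place of $A$ and $\mathcal H$. Then $\|T\|_A$, $\|\mathbb T\|_{\mathbb A}$ and $\omega_{\mathbb A}(\mathbb T)$ are finite, $\|\mathbb T\|_{\mathbb A}\neq 0$, and $$\omega_{\mathbb A}(\mathbb T)=\tfrac12\left(\|\mathbb T\|_{\mathbb A}+\|\mathbb T\|_{\mathbb A}^{-1}\right).$$ Explicitly, $$\omega_{\mathbb A}(\mathbb T)=\tfrac12\sqrt{\|T\|_A^2+4},\qquad \|\mathbb T\|_{\mathbb A}=\tfrac12\sqrt{\|T\|_A^2+4}+\tfrac12\|T\|_A .$$ -/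

import Mathlib

open scoped ENNReal

noncomputable section

namespace SemiHilbert

variable {E : Type*} [NormedAddCommGroup E] [InnerProductSpace ℂ E]

/-- The semi-inner product `⟨x | y⟩_A = ⟨A x | y⟩`, linear in `x` and conjugate-linear in `y`
(Mathlib's `inner` is conjugate-linear in its first argument). -/
def aInner (A : E →L[ℂ] E) (x y : E) : ℂ := inner ℂ y (A x)

/-- The seminorm `‖x‖_A = √⟨x | x⟩_A` on vectors. -/
def aNorm (A : E →L[ℂ] E) (x : E) : ℝ := Real.sqrt (aInner A x x).re

/-- `S` is an `A`-adjoint of `T`: `⟨T x | y⟩_A = ⟨x | S y⟩_A` for all `x`, `y`. -/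
def IsAAdjoint (A T S : E →L[ℂ] E) : Prop :=
  ∀ x y : E, aInner A (T x) y = aInner A x (S y)

/-- `B_A(E)`: the bounded operators that admit a bounded `A`-adjoint. -/
def aAdjointable (A : E →L[ℂ] E) : Set (E →L[ℂ] E) :=
  {T | ∃ S : E →L[ℂ] E, IsAAdjoint A T S}

/-- The `A`-operator seminorm `‖T‖_A = sup {‖T x‖_A ; ‖x‖_A = 1}`, with value `∞` when the set
is unbounded. -/
def aOpNorm (A T : E →L[ℂ] E) : ℝ≥0∞ :=
  ⨆ (x : E) (_ : aNorm A x = 1), ENNReal.ofReal (aNorm A (T x))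

/-- The `A`-numerical radius `ω_A(T) = sup {|⟨T x | x⟩_A| ; ‖x‖_A = 1}`, with value `∞` when the
set is unbounded. -/
def aNumericalRadius (A T : E →L[ℂ] E) : ℝ≥0∞ :=
  ⨆ (x : E) (_ : aNorm A x = 1), ENNReal.ofReal ‖aInner A (T x) x‖

/-- The operator matrix `[[P, Q], [R, S]]` acting on the Hilbert space direct sum `E ⊕ E`. -/
def blockOp (P Q R S : E →L[ℂ] E) : WithLp 2 (E × E) →L[ℂ] WithLp 2 (E × E) :=
  ((WithLp.prodContinuousLinearEquiv 2 ℂ E E).symm : (E × E) →L[ℂ] WithLp 2 (E × E)) ∘L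
    ((P.coprod Q).prod (R.coprod S)) ∘L
    ((WithLp.prodContinuousLinearEquiv 2 ℂ E E) : WithLp 2 (E × E) →L[ℂ] (E × E))

theorem blockOp_apply (P Q R S : E →L[ℂ] E) (z : WithLp 2 (E × E)) :
    blockOp P Q R S z = WithLp.toLp 2 (P z.fst + Q z.snd, R z.fst + S z.snd) := rfl

end SemiHilbert

end

namespace SemiHilbert

/-! ### Factoring the semi-inner product, and finiteness of the seminorm. -/

section Sqrt

variable {H : Type*} [NormedAddCommGroup H] [InnerProductSpace ℂ H]

/-! With `B = √A`, `A`-quantities become ordinary norms and inner products of `B`-images. Everything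
then reduces to the real matrix `[[1, s], [0, -1]]`: Cauchy–Schwarz bounds the block operator by
this matrix at `s = ‖T‖_A`, while pairs `(a x, b y)` with `T y` aligned to `x` realise it at `s = ‖T
y‖_A`. Its norm `M` is the positive root of `M² = 1 + s M`, and its numerical radius is `(M + M⁻¹) /
2`. Inverting these increasing functions of `s` carries the lower bounds to the supremum
(`aOpNorm_shear_eq`, `aNumericalRadius_shear_eq`). Finiteness of `‖T‖_A` is separate:
`aOpNorm_ne_top`. -/

theorem exists_aInner_eq_inner [CompleteSpace H] {A : H →L[ℂ] H} (hA : A.IsPositive) :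
    ∃ B : H →L[ℂ] H, ∀ x y : H, aInner A x y = inner ℂ (B y) (B x) := by
  have hA' : 0 ≤ A := (ContinuousLinearMap.nonneg_iff_isPositive A).2 hA
  have hpos := (ContinuousLinearMap.nonneg_iff_isPositive _).1 (CFC.sqrt_nonneg A)
  refine ⟨CFC.sqrt A, fun x y => ?_⟩
  have h1 : A x = CFC.sqrt A (CFC.sqrt A x) :=
    (congrArg (fun S : H →L[ℂ] H => S x) (CFC.sqrt_mul_sqrt_self A hA')).symm
  rw [aInner, h1]
  exact (hpos.isSymmetric y (CFC.sqrt A x)).symm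

variable {A B : H →L[ℂ] H}

theorem aNorm_eq_norm (hB : ∀ x y : H, aInner A x y = inner ℂ (B y) (B x)) (x : H) :
    aNorm A x = ‖B x‖ := by
  rw [aNorm, hB, norm_eq_sqrt_re_inner (𝕜 := ℂ)]
  rfl

/-- For `B`-symmetric `S` the sequence `‖B (S ^ n x)‖` is log-convex, hence dominates
`‖B (S x)‖ ^ n` when `‖B x‖ = 1`. -/
theorem norm_apply_pow_le {S : H →L[ℂ] H}
    (hS : ∀ x y : H, inner ℂ (B y) (B (S x)) = inner ℂ (B (S y)) (B x))
    {x : H} (hx : ‖B x‖ = 1) (n : ℕ) :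
    ‖B (S x)‖ ^ n ≤ ‖B ((S ^ n) x)‖ := by
  set u : ℕ → ℝ := fun n => ‖B ((S ^ n) x)‖ with hu
  have hsucc : ∀ n, (S ^ (n + 1)) x = S ((S ^ n) x) := fun n => by
    rw [pow_succ']; rfl
  have hu0 : u 0 = 1 := by simpa [hu] using hx
  have hu1 : u 1 = ‖B (S x)‖ := by simp [hu]
  have hlog : ∀ n, u (n + 1) ^ 2 ≤ u n * u (n + 2) := fun n => by
    have h : inner ℂ (B ((S ^ (n + 1)) x)) (B ((S ^ (n + 1)) x))
        = inner ℂ (B ((S ^ n) x)) (B ((S ^ (n + 2)) x)) := by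
      rw [hsucc (n + 1), hS, ← hsucc n]
    have h2 := norm_inner_le_norm (𝕜 := ℂ) (B ((S ^ n) x)) (B ((S ^ (n + 2)) x))
    rw [← h, inner_self_eq_norm_sq_to_K] at h2
    simpa [hu] using h2
  have hnn : ∀ n, 0 ≤ u n := fun n => norm_nonneg _
  rw [← hu1]
  rcases (hnn 1).eq_or_lt with h1 | h1
  · rcases n with _ | n
    · simp [hx]
    · rw [← h1]; simp
  have key : ∀ n, 0 < u n ∧ u 1 * u n ≤ u (n + 1) := fun n => by
    induction n with
    | zero => simp [hu0]
    | succ n ih =>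
      obtain ⟨hp, hle⟩ := ih
      have hp' : 0 < u (n + 1) := lt_of_lt_of_le (mul_pos h1 hp) hle
      refine ⟨hp', le_of_mul_le_mul_left ?_ hp⟩
      nlinarith [hlog n]
  have : ∀ n, u 1 ^ n ≤ u n := fun n => by
    induction n with
    | zero => simp [hu0]
    | succ n ih =>
      rw [pow_succ']
      exact (mul_le_mul_of_nonneg_left ih h1.le).trans (key n).2
  exact this n

theorem le_of_forall_pow_le_mul_pow {a s C : ℝ} (hs : 0 ≤ s)
    (h : ∀ n : ℕ, a ^ n ≤ C * s ^ n) : a ≤ s := by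
  by_contra! hlt
  have ha : 0 < a := hs.trans_lt hlt
  rcases hs.eq_or_lt with rfl | hs
  · have := h 1
    simp at this
    linarith
  obtain ⟨n, hn⟩ := pow_unbounded_of_one_lt C ((one_lt_div hs).2 hlt)
  rw [div_pow, lt_div_iff₀ (pow_pos hs n)] at hn
  exact (h n).not_gt hn

/-- Power trick: `‖B (S ^ n x)‖` grows at most like a constant times `‖S‖ ^ n`, and letting `n` grow
removes the constant, which depends on `x`. -/
theorem norm_apply_le_of_symmetric {S : H →L[ℂ] H}
    (hS : ∀ x y : H, inner ℂ (B y) (B (S x)) = inner ℂ (B (S y)) (B x))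
    {x : H} (hx : ‖B x‖ = 1) : ‖B (S x)‖ ≤ ‖S‖ := by
  refine le_of_forall_pow_le_mul_pow (C := ‖B‖ * ‖x‖) (norm_nonneg _) fun n => ?_
  calc ‖B (S x)‖ ^ n ≤ ‖B ((S ^ n) x)‖ := norm_apply_pow_le hS hx n
    _ ≤ ‖B‖ * (‖S ^ n‖ * ‖x‖) :=
        (B.le_opNorm _).trans (mul_le_mul_of_nonneg_left ((S ^ n).le_opNorm x) (norm_nonneg _))
    _ ≤ ‖B‖ * (‖S‖ ^ n * ‖x‖) := by
        rcases n with _ | n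
        · simp only [pow_zero]
          gcongr
          exact ContinuousLinearMap.norm_id_le
        · gcongr
          exact norm_pow_le' S n.succ_pos
    _ = ‖B‖ * ‖x‖ * ‖S‖ ^ n := by ring

/-- If `R` is an `A`-adjoint, `R T` is `A`-symmetric and `‖T x‖_A² ≤ ‖R T x‖_A ≤ ‖R T‖` on `A`-unit
vectors. -/
theorem aOpNorm_ne_top (hB : ∀ x y : H, aInner A x y = inner ℂ (B y) (B x)) {T : H →L[ℂ] H}
    (hT : T ∈ aAdjointable A) : aOpNorm A T ≠ ∞ := by
  obtain ⟨R, hR⟩ := hT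
  have hR1 : ∀ x y : H, inner ℂ (B y) (B (T x)) = inner ℂ (B (R y)) (B x) := fun x y => by
    rw [← hB, ← hB]; exact hR x y
  have hR2 : ∀ x y : H, inner ℂ (B (T x)) (B y) = inner ℂ (B x) (B (R y)) := fun x y => by
    rw [← inner_conj_symm, hR1, inner_conj_symm]
  have hS : ∀ x y : H, inner ℂ (B y) (B ((R ∘L T) x)) = inner ℂ (B ((R ∘L T) y)) (B x) :=
    fun x y => by
      simp only [ContinuousLinearMap.comp_apply]
      rw [← hR2, hR1]
  refine ne_top_of_le_ne_top (ENNReal.ofReal_ne_top (r := Real.sqrt ‖R ∘L T‖))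
    (iSup₂_le fun x hx => ENNReal.ofReal_le_ofReal ?_)
  rw [aNorm_eq_norm hB] at hx ⊢
  refine Real.le_sqrt_of_sq_le ?_
  have h1 := norm_inner_le_norm (𝕜 := ℂ) (B x) (B (R (T x)))
  rw [← hR2, inner_self_eq_norm_sq_to_K, hx, one_mul] at h1
  have h2 : ‖B (T x)‖ ^ 2 ≤ ‖B (R (T x))‖ := by simpa using h1
  exact h2.trans (norm_apply_le_of_symmetric hS hx)

theorem norm_apply_le_aOpNorm_mul (hB : ∀ x y : H, aInner A x y = inner ℂ (B y) (B x))
    {T : H →L[ℂ] H} (hT : T ∈ aAdjointable A) (x : H) :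
    ‖B (T x)‖ ≤ (aOpNorm A T).toReal * ‖B x‖ := by
  have hunit : ∀ y : H, ‖B y‖ = 1 → ‖B (T y)‖ ≤ (aOpNorm A T).toReal := fun y hy => by
    rw [← ENNReal.ofReal_le_iff_le_toReal (aOpNorm_ne_top hB hT), ← aNorm_eq_norm hB]
    exact le_iSup₂_of_le y ((aNorm_eq_norm hB y).trans hy) le_rfl
  rcases eq_or_ne ‖B x‖ 0 with h0 | h0
  -- Null vectors cannot be normalised; the `A`-adjoint shows that `T` keeps them null.
  · obtain ⟨R, hR⟩ := hT
    have h : inner ℂ (B (T x)) (B (T x)) = inner ℂ (B (R (T x))) (B x) := by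
      rw [← hB, ← hB]; exact hR x (T x)
    rw [norm_eq_zero.1 h0, inner_zero_right, inner_self_eq_zero] at h
    simp [h, h0]
  · have h1 := hunit (((‖B x‖⁻¹ : ℝ) : ℂ) • x) (by
      rw [map_smul, norm_smul]; simp [h0])
    rw [map_smul, map_smul, norm_smul, Complex.norm_real, norm_inv, norm_norm,
      inv_mul_le_iff₀ (by positivity)] at h1
    linarith

/-- Every vector has a unit vector aligned with it for the semi-inner product. -/
theorem exists_norm_eq_one_inner_eq_norm {x₀ : H} (hx₀ : ‖B x₀‖ = 1) (v : H) :
    ∃ x : H, ‖B x‖ = 1 ∧ B v = ((‖B v‖ : ℝ) : ℂ) • B x := by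
  rcases eq_or_ne ‖B v‖ 0 with h0 | h0
  · exact ⟨x₀, hx₀, by rw [norm_eq_zero.1 h0]; simp⟩
  · have h0' : ((‖B v‖ : ℝ) : ℂ) ≠ 0 := by exact_mod_cast h0
    refine ⟨((‖B v‖⁻¹ : ℝ) : ℂ) • v, ?_, ?_⟩
    · rw [map_smul, norm_smul]; simp [h0]
    · rw [map_smul, smul_smul, Complex.ofReal_inv, mul_inv_cancel₀ h0', one_smul]

theorem exists_norm_eq_one (hB : ∀ x y : H, aInner A x y = inner ℂ (B y) (B x)) (hA0 : A ≠ 0) :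
    ∃ x : H, ‖B x‖ = 1 := by
  obtain ⟨x, hx⟩ : ∃ x, B x ≠ 0 := by
    by_contra! h
    refine hA0 (ContinuousLinearMap.ext fun x => ?_)
    have := hB x (A x)
    rw [h x, inner_zero_right, aInner, inner_self_eq_zero] at this
    simpa using this
  refine ⟨((‖B x‖⁻¹ : ℝ) : ℂ) • x, ?_⟩
  rw [map_smul, norm_smul]
  simp [hx]

end Sqrt

/-! ### The semi-inner product on the direct sum. -/

section Block

variable {H : Type*} [NormedAddCommGroup H] [InnerProductSpace ℂ H] {A B : H →L[ℂ] H}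

theorem aInner_blockOp_diag (hB : ∀ x y : H, aInner A x y = inner ℂ (B y) (B x))
    (z w : WithLp 2 (H × H)) :
    aInner (blockOp A 0 0 A) z w
      = inner ℂ (B w.fst) (B z.fst) + inner ℂ (B w.snd) (B z.snd) := by
  rw [← hB, ← hB, aInner, blockOp_apply, WithLp.prod_inner_apply]
  simp [aInner]

theorem aNorm_blockOp_diag (hB : ∀ x y : H, aInner A x y = inner ℂ (B y) (B x))
    (z : WithLp 2 (H × H)) :
    aNorm (blockOp A 0 0 A) z = Real.sqrt (‖B z.fst‖ ^ 2 + ‖B z.snd‖ ^ 2) := by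
  rw [aNorm, aInner_blockOp_diag hB, inner_self_eq_norm_sq_to_K, inner_self_eq_norm_sq_to_K]
  norm_cast

theorem aNorm_blockOp_diag_eq_one_iff (hB : ∀ x y : H, aInner A x y = inner ℂ (B y) (B x))
    (z : WithLp 2 (H × H)) :
    aNorm (blockOp A 0 0 A) z = 1 ↔ ‖B z.fst‖ ^ 2 + ‖B z.snd‖ ^ 2 = 1 := by
  rw [aNorm_blockOp_diag hB, Real.sqrt_eq_one]

end Block

/-! ### Scalar inequalities for the 2 × 2 model. -/

/-- The largest singular value of `[[1, s], [0, -1]]`. -/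
noncomputable def shearNorm (s : ℝ) : ℝ := 1 / 2 * Real.sqrt (s ^ 2 + 4) + 1 / 2 * s

theorem sqrt_sq_add_four_sq (s : ℝ) : Real.sqrt (s ^ 2 + 4) ^ 2 = s ^ 2 + 4 :=
  Real.sq_sqrt (by positivity)

theorem shearNorm_sq (s : ℝ) : shearNorm s ^ 2 = 1 + s * shearNorm s := by
  have := sqrt_sq_add_four_sq s
  unfold shearNorm
  linarith

theorem one_le_shearNorm {s : ℝ} (hs : 0 ≤ s) : 1 ≤ shearNorm s := by
  have : 2 ≤ Real.sqrt (s ^ 2 + 4) := Real.le_sqrt_of_sq_le (by nlinarith)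
  unfold shearNorm
  linarith

theorem half_sqrt_eq_shearNorm {s : ℝ} (hs : 0 ≤ s) :
    1 / 2 * Real.sqrt (s ^ 2 + 4) = 1 / 2 * (shearNorm s + (shearNorm s)⁻¹) := by
  have h0 : 0 < shearNorm s := one_pos.trans_le (one_le_shearNorm hs)
  have h1 : (shearNorm s)⁻¹ = shearNorm s - s :=
    inv_eq_of_mul_eq_one_right (by linarith [shearNorm_sq s])
  rw [h1]
  unfold shearNorm
  ring

/-- The inverse function of `shearNorm` is `N ↦ N - N⁻¹`; the hypothesis is linear in `s`, so it
survives a supremum. -/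
theorem shearNorm_le {s N : ℝ} (hN : 1 ≤ N) (h : s * N ≤ N ^ 2 - 1) : shearNorm s ≤ N := by
  have h1 : Real.sqrt (s ^ 2 + 4) ≤ 2 * N - s := by
    refine Real.sqrt_le_iff.2 ⟨?_, by nlinarith⟩
    nlinarith
  unfold shearNorm
  linarith

theorem shear_quadratic_le {s a b : ℝ} (hs : 0 ≤ s) :
    (a + s * b) ^ 2 + b ^ 2 ≤ shearNorm s ^ 2 * (a ^ 2 + b ^ 2) := by
  have hM := one_le_shearNorm hs
  have h2 := shearNorm_sq s
  set M := shearNorm s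
  have h0 : 0 < M := by linarith
  -- The defect is a square, vanishing at `b = M a`.
  have key : M * (M ^ 2 * (a ^ 2 + b ^ 2) - ((a + s * b) ^ 2 + b ^ 2)) = s * (M * a - b) ^ 2 := by
    have hs' : s = M - M⁻¹ := by field_simp; linarith
    rw [hs']
    field_simp
    ring
  have : 0 ≤ M * (M ^ 2 * (a ^ 2 + b ^ 2) - ((a + s * b) ^ 2 + b ^ 2)) := by
    rw [key]; positivity
  nlinarith [nonneg_of_mul_nonneg_right this h0]

/-- Cauchy–Schwarz for `(2, s)` against the unit vector `(|a² - b²|, 2ab)`. -/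
theorem abs_shear_form_le {s a b : ℝ} (h : a ^ 2 + b ^ 2 = 1) :
    |a ^ 2 - b ^ 2| + s * (a * b) ≤ 1 / 2 * Real.sqrt (s ^ 2 + 4) := by
  have h1 : 2 * (|a ^ 2 - b ^ 2| + s * (a * b)) ≤ Real.sqrt (s ^ 2 + 4) := by
    refine Real.le_sqrt_of_sq_le ?_
    have h2 : |a ^ 2 - b ^ 2| ^ 2 + 4 * (a * b) ^ 2 = 1 := by
      rw [sq_abs]
      linear_combination (a ^ 2 + b ^ 2 + 1) * h
    nlinarith [sq_nonneg (s * |a ^ 2 - b ^ 2| - 4 * (a * b))]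
  linarith

/-! ### The block operator compared with its model. -/

section Shear

variable {H : Type*} [NormedAddCommGroup H] [InnerProductSpace ℂ H] {A B T : H →L[ℂ] H}

/-- The operator matrix `[[I, T], [0, -I]]`. -/
abbrev shear (T : H →L[ℂ] H) : WithLp 2 (H × H) →L[ℂ] WithLp 2 (H × H) :=
  blockOp (ContinuousLinearMap.id ℂ H) T 0 (-ContinuousLinearMap.id ℂ H)

theorem aNorm_shear (hB : ∀ x y : H, aInner A x y = inner ℂ (B y) (B x))
    (z : WithLp 2 (H × H)) :
    aNorm (blockOp A 0 0 A) (shear T z)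
      = Real.sqrt (‖B z.fst + B (T z.snd)‖ ^ 2 + ‖B z.snd‖ ^ 2) := by
  rw [aNorm_blockOp_diag hB, blockOp_apply]
  simp

theorem aInner_shear (hB : ∀ x y : H, aInner A x y = inner ℂ (B y) (B x))
    (z : WithLp 2 (H × H)) :
    aInner (blockOp A 0 0 A) (shear T z) z
      = ((‖B z.fst‖ ^ 2 - ‖B z.snd‖ ^ 2 : ℝ) : ℂ) + inner ℂ (B z.fst) (B (T z.snd)) := by
  rw [aInner_blockOp_diag hB, blockOp_apply]
  simp [inner_neg_right, inner_self_eq_norm_sq_to_K]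
  ring

theorem aOpNorm_shear_le (hB : ∀ x y : H, aInner A x y = inner ℂ (B y) (B x))
    (hT : T ∈ aAdjointable A) :
    aOpNorm (blockOp A 0 0 A) (shear T) ≤ ENNReal.ofReal (shearNorm (aOpNorm A T).toReal) := by
  refine iSup₂_le fun z hz => ENNReal.ofReal_le_ofReal ?_
  rw [aNorm_blockOp_diag_eq_one_iff hB] at hz
  set t := (aOpNorm A T).toReal with ht
  have ht0 : 0 ≤ t := ENNReal.toReal_nonneg
  rw [aNorm_shear hB]
  refine Real.sqrt_le_iff.2 ⟨zero_le_one.trans (one_le_shearNorm ht0), ?_⟩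
  have h1 : ‖B z.fst + B (T z.snd)‖ ≤ ‖B z.fst‖ + t * ‖B z.snd‖ :=
    (norm_add_le _ _).trans (add_le_add_right (norm_apply_le_aOpNorm_mul hB hT _) _)
  have h2 := shear_quadratic_le (a := ‖B z.fst‖) (b := ‖B z.snd‖) ht0
  rw [hz, mul_one] at h2
  refine le_trans ?_ h2
  gcongr

theorem aNumericalRadius_shear_le (hB : ∀ x y : H, aInner A x y = inner ℂ (B y) (B x))
    (hT : T ∈ aAdjointable A) :
    aNumericalRadius (blockOp A 0 0 A) (shear T)
      ≤ ENNReal.ofReal (1 / 2 * Real.sqrt ((aOpNorm A T).toReal ^ 2 + 4)) := by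
  refine iSup₂_le fun z hz => ENNReal.ofReal_le_ofReal ?_
  rw [aNorm_blockOp_diag_eq_one_iff hB] at hz
  rw [aInner_shear hB]
  refine le_trans ?_ (abs_shear_form_le hz)
  refine (norm_add_le _ _).trans (add_le_add ?_ ?_)
  · rw [Complex.norm_real, Real.norm_eq_abs]
  · refine (norm_inner_le_norm _ _).trans ?_
    have := norm_apply_le_aOpNorm_mul hB hT z.snd
    calc ‖B z.fst‖ * ‖B (T z.snd)‖
        ≤ ‖B z.fst‖ * ((aOpNorm A T).toReal * ‖B z.snd‖) := by gcongr
      _ = _ := by ring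

variable {x y : H} {a b : ℝ}

theorem aNorm_smul_pair (hB : ∀ x y : H, aInner A x y = inner ℂ (B y) (B x))
    (hx : ‖B x‖ = 1) (hy : ‖B y‖ = 1) (hab : a ^ 2 + b ^ 2 = 1) :
    aNorm (blockOp A 0 0 A) (WithLp.toLp 2 ((a : ℂ) • x, (b : ℂ) • y)) = 1 := by
  rw [aNorm_blockOp_diag_eq_one_iff hB]
  simp [norm_smul, hx, hy, hab]

theorem le_aOpNorm_shear (hB : ∀ x y : H, aInner A x y = inner ℂ (B y) (B x))
    (hx : ‖B x‖ = 1) (hy : ‖B y‖ = 1) (hxy : B (T y) = ((‖B (T y)‖ : ℝ) : ℂ) • B x)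
    (hab : a ^ 2 + b ^ 2 = 1) :
    ENNReal.ofReal (Real.sqrt ((a + ‖B (T y)‖ * b) ^ 2 + b ^ 2))
      ≤ aOpNorm (blockOp A 0 0 A) (shear T) := by
  refine le_iSup₂_of_le _ (aNorm_smul_pair hB hx hy hab) (le_of_eq ?_)
  rw [aNorm_shear hB]
  have h : B ((a : ℂ) • x) + B (T ((b : ℂ) • y)) = ((a + ‖B (T y)‖ * b : ℝ) : ℂ) • B x := by
    rw [map_smul, map_smul, map_smul, hxy, smul_smul, ← add_smul, norm_smul, hx]
    congr 1
    simp [mul_comm]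
  rw [WithLp.toLp_fst, WithLp.toLp_snd, h]
  simp only [map_smul, norm_smul, hx, hy, Complex.norm_real, Real.norm_eq_abs, mul_one, sq_abs]

theorem le_aNumericalRadius_shear (hB : ∀ x y : H, aInner A x y = inner ℂ (B y) (B x))
    (hx : ‖B x‖ = 1) (hy : ‖B y‖ = 1) (hxy : B (T y) = ((‖B (T y)‖ : ℝ) : ℂ) • B x)
    (hab : a ^ 2 + b ^ 2 = 1) :
    ENNReal.ofReal (a ^ 2 - b ^ 2 + ‖B (T y)‖ * (a * b))
      ≤ aNumericalRadius (blockOp A 0 0 A) (shear T) := by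
  refine le_iSup₂_of_le _ (aNorm_smul_pair hB hx hy hab) (ENNReal.ofReal_le_ofReal ?_)
  rw [aInner_shear hB]
  have h : inner ℂ (B ((a : ℂ) • x)) (B (T ((b : ℂ) • y))) = ((‖B (T y)‖ * (a * b) : ℝ) : ℂ) := by
    rw [map_smul, map_smul, map_smul, hxy, smul_smul, inner_smul_left, inner_smul_right,
      inner_self_eq_norm_sq_to_K, norm_smul, hx]
    simp
    ring
  rw [WithLp.toLp_fst, WithLp.toLp_snd, h]
  simp only [map_smul, norm_smul, hx, hy, Complex.norm_real, Real.norm_eq_abs, mul_one, sq_abs]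
  rw [← Complex.ofReal_add, Complex.norm_real]
  exact le_abs_self _

theorem shearNorm_le_aOpNorm_shear (hB : ∀ x y : H, aInner A x y = inner ℂ (B y) (B x))
    (hx : ‖B x‖ = 1) (hy : ‖B y‖ = 1) (hxy : B (T y) = ((‖B (T y)‖ : ℝ) : ℂ) • B x) :
    ENNReal.ofReal (shearNorm ‖B (T y)‖) ≤ aOpNorm (blockOp A 0 0 A) (shear T) := by
  set s := ‖B (T y)‖ with hs
  have hM := one_le_shearNorm (norm_nonneg (B (T y)))
  rw [← hs] at hM
  have h2 := shearNorm_sq s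
  set M := shearNorm s
  have h0 : 0 < M := by linarith
  have hr : Real.sqrt (1 + M ^ 2) ^ 2 = 1 + M ^ 2 := Real.sq_sqrt (by positivity)
  have hr0 : 0 < Real.sqrt (1 + M ^ 2) := Real.sqrt_pos.2 (by positivity)
  set r := Real.sqrt (1 + M ^ 2)
  -- The equality case `b = M a` of `shear_quadratic_le`, normalised.
  have hab : (1 / r) ^ 2 + (M / r) ^ 2 = 1 := by
    field_simp
    linarith
  refine le_trans (ENNReal.ofReal_le_ofReal ?_) (le_aOpNorm_shear hB hx hy hxy hab)
  refine Real.le_sqrt_of_sq_le (le_of_eq ?_)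
  have h3 : 1 / r + s * (M / r) = M ^ 2 / r := by
    rw [h2]; ring
  rw [← hs, h3]
  field_simp
  rw [hr]
  ring

theorem half_sqrt_le_aNumericalRadius_shear
    (hB : ∀ x y : H, aInner A x y = inner ℂ (B y) (B x))
    (hx : ‖B x‖ = 1) (hy : ‖B y‖ = 1) (hxy : B (T y) = ((‖B (T y)‖ : ℝ) : ℂ) • B x) :
    ENNReal.ofReal (1 / 2 * Real.sqrt (‖B (T y)‖ ^ 2 + 4))
      ≤ aNumericalRadius (blockOp A 0 0 A) (shear T) := by
  rw [half_sqrt_eq_shearNorm (norm_nonneg _)]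
  set s := ‖B (T y)‖ with hs
  have hM := one_le_shearNorm (norm_nonneg (B (T y)))
  rw [← hs] at hM
  have h2 := shearNorm_sq s
  set M := shearNorm s
  have h0 : 0 < M := by linarith
  have hr : Real.sqrt (2 * M ^ 2 + 2) ^ 2 = 2 * M ^ 2 + 2 := Real.sq_sqrt (by positivity)
  have hr0 : 0 < Real.sqrt (2 * M ^ 2 + 2) := Real.sqrt_pos.2 (by positivity)
  set r := Real.sqrt (2 * M ^ 2 + 2)
  -- `(M + 1, M - 1)` is the top eigenvector of the symmetric part `[[1, s/2], [s/2, -1]]`, with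
  -- eigenvalue `(M + M⁻¹) / 2`.
  have hab : ((M + 1) / r) ^ 2 + ((M - 1) / r) ^ 2 = 1 := by
    field_simp
    linarith
  refine le_trans (ENNReal.ofReal_le_ofReal (le_of_eq ?_))
    (le_aNumericalRadius_shear hB hx hy hxy hab)
  rw [← hs]
  have hs' : s = M - M⁻¹ := by field_simp; linarith
  rw [hs']
  field_simp
  rw [hr]
  ring

theorem aOpNorm_shear_eq (hB : ∀ x y : H, aInner A x y = inner ℂ (B y) (B x))
    (hA0 : A ≠ 0) (hT : T ∈ aAdjointable A) :
    aOpNorm (blockOp A 0 0 A) (shear T) = ENNReal.ofReal (shearNorm (aOpNorm A T).toReal) := by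
  refine le_antisymm (aOpNorm_shear_le hB hT) ?_
  have htop : aOpNorm (blockOp A 0 0 A) (shear T) ≠ ∞ :=
    ne_top_of_le_ne_top ENNReal.ofReal_ne_top (aOpNorm_shear_le hB hT)
  obtain ⟨x₀, hx₀⟩ := exists_norm_eq_one hB hA0
  have hle : ∀ y : H, ‖B y‖ = 1 →
      shearNorm ‖B (T y)‖ ≤ (aOpNorm (blockOp A 0 0 A) (shear T)).toReal := fun y hy => by
    obtain ⟨x, hx, hxy⟩ := exists_norm_eq_one_inner_eq_norm hx₀ (T y)
    exact (ENNReal.ofReal_le_iff_le_toReal htop).1 (shearNorm_le_aOpNorm_shear hB hx hy hxy)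
  set N := (aOpNorm (blockOp A 0 0 A) (shear T)).toReal
  have hN : 1 ≤ N := (one_le_shearNorm (norm_nonneg _)).trans (hle x₀ hx₀)
  refine (ENNReal.ofReal_le_iff_le_toReal htop).2 (shearNorm_le hN ?_)
  have hN0 : 0 < N := one_pos.trans_le hN
  rw [← le_div_iff₀ hN0]
  -- Each `‖T y‖_A` is at most `N - N⁻¹`, hence so is the supremum.
  refine ENNReal.toReal_le_of_le_ofReal (div_nonneg (by nlinarith) hN0.le)
    (iSup₂_le fun y hy => ENNReal.ofReal_le_ofReal ?_)
  rw [aNorm_eq_norm hB] at hy ⊢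
  have h1 := hle y hy
  have h2 := shearNorm_sq ‖B (T y)‖
  have h3 := one_le_shearNorm (norm_nonneg (B (T y)))
  rw [le_div_iff₀ hN0]
  nlinarith [norm_nonneg (B (T y)), mul_nonneg (sub_nonneg.2 h1) (sub_nonneg.2 h3)]

theorem aNumericalRadius_shear_eq (hB : ∀ x y : H, aInner A x y = inner ℂ (B y) (B x))
    (hA0 : A ≠ 0) (hT : T ∈ aAdjointable A) :
    aNumericalRadius (blockOp A 0 0 A) (shear T)
      = ENNReal.ofReal (1 / 2 * Real.sqrt ((aOpNorm A T).toReal ^ 2 + 4)) := by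
  refine le_antisymm (aNumericalRadius_shear_le hB hT) ?_
  have htop : aNumericalRadius (blockOp A 0 0 A) (shear T) ≠ ∞ :=
    ne_top_of_le_ne_top ENNReal.ofReal_ne_top (aNumericalRadius_shear_le hB hT)
  obtain ⟨x₀, hx₀⟩ := exists_norm_eq_one hB hA0
  have hle : ∀ y : H, ‖B y‖ = 1 → 1 / 2 * Real.sqrt (‖B (T y)‖ ^ 2 + 4)
      ≤ (aNumericalRadius (blockOp A 0 0 A) (shear T)).toReal := fun y hy => by
    obtain ⟨x, hx, hxy⟩ := exists_norm_eq_one_inner_eq_norm hx₀ (T y)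
    exact (ENNReal.ofReal_le_iff_le_toReal htop).1
      (half_sqrt_le_aNumericalRadius_shear hB hx hy hxy)
  set W := (aNumericalRadius (blockOp A 0 0 A) (shear T)).toReal
  have hsq : ∀ y : H, ‖B y‖ = 1 → ‖B (T y)‖ ^ 2 + 4 ≤ (2 * W) ^ 2 := fun y hy =>
    (Real.sqrt_le_iff.1 (by linarith [hle y hy])).2
  have hW : 0 ≤ W := ENNReal.toReal_nonneg
  refine (ENNReal.ofReal_le_iff_le_toReal htop).2 ?_
  have ht : (aOpNorm A T).toReal ≤ Real.sqrt ((2 * W) ^ 2 - 4) := by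
    refine ENNReal.toReal_le_of_le_ofReal (Real.sqrt_nonneg _)
      (iSup₂_le fun y hy => ENNReal.ofReal_le_ofReal ?_)
    rw [aNorm_eq_norm hB] at hy ⊢
    exact Real.le_sqrt_of_sq_le (by linarith [hsq y hy])
  -- The existence of an `A`-unit vector is what makes the radicand nonnegative.
  have h4 : 0 ≤ (2 * W) ^ 2 - 4 := by nlinarith [hsq x₀ hx₀, sq_nonneg ‖B (T x₀)‖]
  have h5 : (aOpNorm A T).toReal ^ 2 ≤ (2 * W) ^ 2 - 4 :=
    (Real.le_sqrt ENNReal.toReal_nonneg h4).1 ht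
  have h6 : Real.sqrt ((aOpNorm A T).toReal ^ 2 + 4) ≤ 2 * W :=
    Real.sqrt_le_iff.2 ⟨by positivity, by linarith⟩
  linarith

end Shear

end SemiHilbert

theorem mainTheorem4 {H : Type*} [NormedAddCommGroup H] [InnerProductSpace ℂ H] [CompleteSpace H]
    (A : H →L[ℂ] H) (hA : A.IsPositive) (hA0 : A ≠ 0)
    (T : H →L[ℂ] H) (hT : T ∈ SemiHilbert.aAdjointable A)
    (hinv : ∀ x ∈ (LinearMap.ker (A : H →ₗ[ℂ] H))ᗮ, T x ∈ (LinearMap.ker (A : H →ₗ[ℂ] H))ᗮ)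
    (AA TT : WithLp 2 (H × H) →L[ℂ] WithLp 2 (H × H))
    (hAA : AA = SemiHilbert.blockOp A 0 0 A)
    (hTT : TT = SemiHilbert.blockOp (ContinuousLinearMap.id ℂ H) T 0
      (-ContinuousLinearMap.id ℂ H)) :
    (SemiHilbert.aOpNorm A T ≠ ∞ ∧ SemiHilbert.aOpNorm AA TT ≠ ∞ ∧
        SemiHilbert.aNumericalRadius AA TT ≠ ∞) ∧
      SemiHilbert.aOpNorm AA TT ≠ 0 ∧
      (SemiHilbert.aNumericalRadius AA TT).toReal =
        1 / 2 * ((SemiHilbert.aOpNorm AA TT).toReal + (SemiHilbert.aOpNorm AA TT).toReal⁻¹) ∧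
      (SemiHilbert.aNumericalRadius AA TT).toReal =
        1 / 2 * Real.sqrt ((SemiHilbert.aOpNorm A T).toReal ^ 2 + 4) ∧
      (SemiHilbert.aOpNorm AA TT).toReal =
        1 / 2 * Real.sqrt ((SemiHilbert.aOpNorm A T).toReal ^ 2 + 4) +
          1 / 2 * (SemiHilbert.aOpNorm A T).toReal := by
  obtain ⟨B, hB⟩ := SemiHilbert.exists_aInner_eq_inner hA
  have h1 := SemiHilbert.aOpNorm_shear_eq hB hA0 hT
  have h2 := SemiHilbert.aNumericalRadius_shear_eq hB hA0 hT
  have ht0 : 0 ≤ (SemiHilbert.aOpNorm A T).toReal := ENNReal.toReal_nonneg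
  have hM := SemiHilbert.one_le_shearNorm ht0
  subst hAA hTT
  rw [h1, h2, ENNReal.toReal_ofReal (by positivity), ENNReal.toReal_ofReal (by linarith)]
  refine ⟨⟨SemiHilbert.aOpNorm_ne_top hB hT, ENNReal.ofReal_ne_top, ENNReal.ofReal_ne_top⟩,
    ?_, SemiHilbert.half_sqrt_eq_shearNorm ht0, rfl, rfl⟩
  exact (ENNReal.ofReal_pos.2 (by linarith)).ne'
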